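/- Let $\Omega\subset\mathbb R^3$ be a bounded domain and let $W^0\to W^1\to W^2\to W^3$ be its complex $L^2$ de Rham complex in vector proxies, $W^0=W^3=L^2(\Omega;\mathbb C)$, $W^1=W^2=L^2(\Omega;\mathbb C^3)$, with $d=\nabla,\ \nabla\times,\ \nabla\cdot$ in the sense of distributions. Let $V^0\to V^1\to V^2\to V^3=W^3$ be a dense closed subcomplex: each $V^k\subset W^k$ is a dense subspace on which $d$ is defined with values in $V^{k+1}$, and $(d,V^k)$ is a closed operator. (The choice of the $V^k$ encodes the boundary conditions.) Let $V_k^*\subset W^k$ be the domain of the Hilbert space adjoint $d^*$ of $(d,V^{k-1})$, and assume the compactness property: for each $k$ the inclusion $V^k\cap V_k^*\to W^k$ is compact, where $V^k\cap V^*_k$ has the norm $\|v\|+\|dv\|+\|d^*v\|$ (with $d=0$ on $V^3$ and $d^*=0$ on $V_0^*=W^0$). Let $\mathfrak H^3:=(dV^2)^{\perp}\subset W^3$ be the space of harmonic $3$-forms. Let $\nu>0$, $\lambda>0$, let $l_3:W^1\to W^2$ and $l_5:W^2\to W^2$ be bounded linear maps, and let $\langle a,b\rangle=\int_\Omega a\cdot\bar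 b$. Define $$\overline{L_\lambda}:\ (V^2\cap V_2^*)\times(V_3^*\cap\mathfrak H^{3\perp})\ \to\ \big(V_2^*\times(W^3\cap\mathfrak H^{3\perp})\big)',$$ $$\overline{L_\lambda}(u,p)(v,q):=\langle\nu d^*u,d^*v\rangle+\langle l_3d^*u+l_5u-\lambda d^*p,v\rangle+\langle\lambda\,du,q\rangle ,$$ where $V_2^*$ and $V_3^*$ have the norms $\|v\|+\|d^*v\|$, and $'$ denotes the space of bounded antilinear functionals. Write $\langle\cdot,\cdot\rangle$ also for the map $(u,p)\mapsto\big((v,q)\mapsto\langle u,v\rangle+\langle p,q\rangle\big)$ between the same spaces. Then there is an at most countable set $S\subset\mathbb C$ such that for every $\gamma\in\mathbb C\setminus S$ the operator $\overline{L_\lambda}+\gamma\langle\cdot,\cdot\rangle$ is a bounded isomorphism (a bounded linear bijection with bounded inverse) from $(V^2\cap V_2^*)\times(V_3^*\cap\mathfrak H^{3\perp})$ onto $\big(V_2^*\times(W^3\cap\mathfrak H^{3\perp})\big)'$. -/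

import Mathlib

open MeasureTheory
open scoped ContDiff

noncomputable section

namespace FluidComplex

/-! ### The `L²` spaces on a domain of `ℝ³` and weak vector calculus -/

/-- Three-dimensional Euclidean space. -/
abbrev E3 : Type := EuclideanSpace ℝ (Fin 3)

/-- `L²(Ω; ℂ)`, the space `W⁰ = W³` of (proxies of) square integrable `0`- and `3`-forms. -/
abbrev L2S (Ω : Set E3) : Type := Lp ℂ 2 (volume.restrict Ω)

/-- `L²(Ω; ℂ³)`, the space `W¹ = W²` of (proxies of) square integrable `1`- and `2`-forms. -/
abbrev L2V (Ω : Set E3) : Type := Lp (EuclideanSpace ℂ (Fin 3)) 2 (volume.restrict Ω)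

/-- Smooth real functions with compact support in `Ω`. -/
def IsTest (Ω : Set E3) (φ : E3 → ℝ) : Prop :=
  ContDiff ℝ ∞ φ ∧ HasCompactSupport φ ∧ tsupport φ ⊆ Ω

/-- The partial derivative `∂ᵢ φ`. -/
def pd (i : Fin 3) (φ : E3 → ℝ) (x : E3) : ℝ := fderiv ℝ φ x (EuclideanSpace.single i 1)

/-- `g = ∇ u` in the sense of distributions on `Ω`. -/
def HasWeakGrad {Ω : Set E3} (u : L2S Ω) (g : L2V Ω) : Prop :=
  ∀ φ : E3 → ℝ, IsTest Ω φ → ∀ i : Fin 3,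
    ∫ x in Ω, (φ x : ℂ) * g x i = -∫ x in Ω, (pd i φ x : ℂ) * u x

/-- `c = ∇ × w` in the sense of distributions on `Ω`; indices are taken modulo `3`, so that
`cᵢ = ∂ᵢ₊₁ wᵢ₊₂ - ∂ᵢ₊₂ wᵢ₊₁`. -/
def HasWeakCurl {Ω : Set E3} (w c : L2V Ω) : Prop :=
  ∀ φ : E3 → ℝ, IsTest Ω φ → ∀ i : Fin 3,
    ∫ x in Ω, (φ x : ℂ) * c x i =
      -∫ x in Ω, ((pd (i + 1) φ x : ℂ) * w x (i + 2) - (pd (i + 2) φ x : ℂ) * w x (i + 1))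

/-- `s = ∇ · w` in the sense of distributions on `Ω`. -/
def HasWeakDiv {Ω : Set E3} (w : L2V Ω) (s : L2S Ω) : Prop :=
  ∀ φ : E3 → ℝ, IsTest Ω φ →
    ∫ x in Ω, (φ x : ℂ) * s x = -∫ x in Ω, ∑ i : Fin 3, (pd i φ x : ℂ) * w x i

/-! ### Intersections of operator domains with their graph norm -/

section DomInter

variable {H F G : Type*} [NormedAddCommGroup H] [InnerProductSpace ℂ H]
  [NormedAddCommGroup F] [InnerProductSpace ℂ F]
  [NormedAddCommGroup G] [InnerProductSpace ℂ G]

/-- The intersection `dom S ∩ dom T` of the domains of two unbounded operators, to be normed by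
`‖x‖ + ‖S x‖ + ‖T x‖`. -/
def DomInter (S : H →ₗ.[ℂ] F) (T : H →ₗ.[ℂ] G) : Type _ :=
  ↥(S.domain ⊓ T.domain)

namespace DomInter

variable (S : H →ₗ.[ℂ] F) (T : H →ₗ.[ℂ] G)

instance : AddCommGroup (DomInter S T) :=
  inferInstanceAs (AddCommGroup ↥(S.domain ⊓ T.domain))

instance : Module ℂ (DomInter S T) :=
  inferInstanceAs (Module ℂ ↥(S.domain ⊓ T.domain))

/-- The inclusion into the ambient space, as a linear map. -/
def inclₗ : DomInter S T →ₗ[ℂ] H := (S.domain ⊓ T.domain).subtype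

/-- `x ↦ S x`, as a linear map. -/
def fstₗ : DomInter S T →ₗ[ℂ] F := S.toFun ∘ₗ Submodule.inclusion inf_le_left

/-- `x ↦ T x`, as a linear map. -/
def sndₗ : DomInter S T →ₗ[ℂ] G := T.toFun ∘ₗ Submodule.inclusion inf_le_right

instance : Norm (DomInter S T) := ⟨fun x => ‖inclₗ S T x‖ + ‖fstₗ S T x‖ + ‖sndₗ S T x‖⟩

theorem norm_def (x : DomInter S T) :
    ‖x‖ = ‖inclₗ S T x‖ + ‖fstₗ S T x‖ + ‖sndₗ S T x‖ := rfl

theorem core : NormedSpace.Core ℂ (DomInter S T) where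
  norm_nonneg x := by rw [norm_def]; positivity
  norm_smul c x := by simp only [norm_def, map_smul, norm_smul]; ring
  norm_triangle x y := by
    simp only [norm_def, map_add]
    linarith [norm_add_le (inclₗ S T x) (inclₗ S T y), norm_add_le (fstₗ S T x) (fstₗ S T y),
      norm_add_le (sndₗ S T x) (sndₗ S T y)]
  norm_eq_zero_iff x := by
    constructor
    · intro h
      rw [norm_def] at h
      have h0 : ‖inclₗ S T x‖ = 0 := by
        linarith [norm_nonneg (inclₗ S T x), norm_nonneg (fstₗ S T x), norm_nonneg (sndₗ S T x)]
      exact Subtype.ext (norm_eq_zero.mp h0)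
    · rintro rfl
      simp [norm_def]

instance : NormedAddCommGroup (DomInter S T) := NormedAddCommGroup.ofCore (core S T)

instance : NormedSpace ℂ (DomInter S T) := NormedSpace.ofCore (core S T)

/-- The bounded inclusion `x ↦ x` into the ambient space. -/
def incl : DomInter S T →L[ℂ] H :=
  (inclₗ S T).mkContinuous 1 fun x => by
    rw [norm_def]; linarith [norm_nonneg (fstₗ S T x), norm_nonneg (sndₗ S T x)]

/-- The bounded operator `x ↦ S x`. -/
def fst : DomInter S T →L[ℂ] F :=
  (fstₗ S T).mkContinuous 1 fun x => by
    rw [norm_def]; linarith [norm_nonneg (inclₗ S T x), norm_nonneg (sndₗ S T x)]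

/-- The bounded operator `x ↦ T x`. -/
def snd : DomInter S T →L[ℂ] G :=
  (sndₗ S T).mkContinuous 1 fun x => by
    rw [norm_def]; linarith [norm_nonneg (inclₗ S T x), norm_nonneg (fstₗ S T x)]

end DomInter

end DomInter

/-! ### Domain complexes inside the `L²` de Rham complex -/

/-- A dense closed subcomplex `V⁰ → V¹ → V² → V³` of the `L²` de Rham complex of `Ω`:
`Vᵏ` is the domain of `dᵏ`, a closed densely defined restriction of the weak gradient, curl,
divergence respectively (so that `Vᵏ` is complete for the norm `‖v‖ + ‖d v‖`), `d` maps `Vᵏ` into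
`Vᵏ⁺¹`, `V³ = L²(Ω)` and `d³ = 0`.
The choice of the domains encodes the boundary conditions. -/
structure DeRham (Ω : Set E3) where
  /-- the gradient with domain `V⁰` -/
  d0 : L2S Ω →ₗ.[ℂ] L2V Ω
  /-- the curl with domain `V¹` -/
  d1 : L2V Ω →ₗ.[ℂ] L2V Ω
  /-- the divergence with domain `V²` -/
  d2 : L2V Ω →ₗ.[ℂ] L2S Ω
  d0_grad : ∀ u : d0.domain, HasWeakGrad (u : L2S Ω) (d0 u)
  d1_curl : ∀ u : d1.domain, HasWeakCurl (u : L2V Ω) (d1 u)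
  d2_div : ∀ u : d2.domain, HasWeakDiv (u : L2V Ω) (d2 u)
  d0_dense : Dense (d0.domain : Set (L2S Ω))
  d1_dense : Dense (d1.domain : Set (L2V Ω))
  d2_dense : Dense (d2.domain : Set (L2V Ω))
  d0_closed : d0.IsClosed
  d1_closed : d1.IsClosed
  d2_closed : d2.IsClosed
  d0_mem : ∀ u : d0.domain, d0 u ∈ d1.domain
  d1_mem : ∀ u : d1.domain, d1 u ∈ d2.domain

namespace DeRham

variable {Ω : Set E3} (C : DeRham Ω)

/-- The codifferential `d* : V₁* ⊆ W¹ → W⁰`, adjoint of `(d, V⁰)`. -/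
def dstar1 : L2V Ω →ₗ.[ℂ] L2S Ω := C.d0.adjoint

/-- The codifferential `d* : V₂* ⊆ W² → W¹`, adjoint of `(d, V¹)`. -/
def dstar2 : L2V Ω →ₗ.[ℂ] L2V Ω := C.d1.adjoint

/-- The codifferential `d* : V₃* ⊆ W³ → W²`, adjoint of `(d, V²)`. -/
def dstar3 : L2S Ω →ₗ.[ℂ] L2V Ω := C.d2.adjoint

/-- The everywhere defined zero operator: the differential leaving degree `3` and the
codifferential leaving degree `0`. -/
abbrev zeroOp (H : Type*) [NormedAddCommGroup H] [InnerProductSpace ℂ H] : H →ₗ.[ℂ] ℂ := 0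

/-- The compactness property: the inclusion `Vᵏ ∩ Vₖ* → Wᵏ` is compact for `k = 0, 1, 2, 3`. -/
structure CompactnessProperty : Prop where
  deg0 : IsCompactOperator (DomInter.incl C.d0 (zeroOp (L2S Ω)))
  deg1 : IsCompactOperator (DomInter.incl C.d1 C.dstar1)
  deg2 : IsCompactOperator (DomInter.incl C.d2 C.dstar2)
  deg3 : IsCompactOperator (DomInter.incl (zeroOp (L2S Ω)) C.dstar3)

/-- `𝔅³ = d V²`. -/
def boundaries3 : Submodule ℂ (L2S Ω) := LinearMap.range C.d2.toFun

/-- The harmonic `3`-forms `ℌ³ = ℨ³ ∩ (𝔅³)^⊥`, where `ℨ³ = V³ = L²(Ω)` because `d³ = 0`. -/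
def harmonic3 : Submodule ℂ (L2S Ω) := C.boundaries3ᗮ

/-- `V² ∩ V₂*`, with norm `‖u‖ + ‖d u‖ + ‖d* u‖`. -/
abbrev V2V2star : Type := DomInter C.d2 C.dstar2

/-- `V₂*`, with norm `‖v‖ + ‖d* v‖`. -/
abbrev V2star : Type := DomInter (zeroOp (L2V Ω)) C.dstar2

/-- `V₃*`, with norm `‖p‖ + ‖d* p‖`. -/
abbrev V3star : Type := DomInter (zeroOp (L2S Ω)) C.dstar3

/-- `V₃* ∩ (ℌ³)^⊥` as a subspace of `V₃*`. -/
def V3starPerp : Submodule ℂ C.V3star :=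
  C.harmonic3ᗮ.comap (DomInter.inclₗ (zeroOp (L2S Ω)) C.dstar3)

/-- `W³ ∩ (ℌ³)^⊥`. -/
abbrev W3Perp : Submodule ℂ (L2S Ω) := C.harmonic3ᗮ

/-- The space `(V² ∩ V₂*) × (V₃* ∩ (ℌ³)^⊥)` of trial functions `(u, p)`. -/
abbrev Trial : Type := C.V2V2star × ↥C.V3starPerp

/-- The space `V₂* × (W³ ∩ (ℌ³)^⊥)` of test functions `(v, q)`. -/
abbrev TestSpace : Type := C.V2star × ↥C.W3Perp

/-- The dual `(V₂* × (W³ ∩ (ℌ³)^⊥))'`: the bounded antilinear functionals of `(v, q)`, the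
Hermitian pairing `⟨a, b⟩ = ∫ a · conj b` being linear in `a` and antilinear in `b`. -/
abbrev TestDual : Type := C.TestSpace →L⋆[ℂ] ℂ

end DeRham

/-! ### The operators -/

section Pairing

variable {X Y H : Type*} [NormedAddCommGroup X] [NormedSpace ℂ X]
  [NormedAddCommGroup Y] [NormedSpace ℂ Y] [NormedAddCommGroup H] [InnerProductSpace ℂ H]

/-- For bounded `A : X → H` and `B : Y → H`, the bounded operator `X → Y'`,
`x ↦ (y ↦ ⟨A x, B y⟩)`, linear in `x` and antilinear in `y` (Mathlib's `inner ℂ a b` is antilinear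
in `a`). -/
def pairing (A : X →L[ℂ] H) (B : Y →L[ℂ] H) : X →L[ℂ] (Y →L⋆[ℂ] ℂ) :=
  LinearMap.mkContinuous₂
    (LinearMap.mk₂'ₛₗ (RingHom.id ℂ) (starRingEnd ℂ) (fun x y => inner ℂ (B y) (A x))
      (fun x x' y => by simp)
      (fun c x y => by simp)
      (fun x y y' => by simp)
      (fun c x y => by simp [mul_comm]))
    (‖A‖ * ‖B‖)
    (fun x y => by
      calc ‖inner ℂ (B y) (A x)‖ ≤ ‖B y‖ * ‖A x‖ := norm_inner_le_norm _ _
        _ ≤ (‖B‖ * ‖y‖) * (‖A‖ * ‖x‖) := by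
            gcongr
            · exact B.le_opNorm y
            · exact A.le_opNorm x
        _ = ‖A‖ * ‖B‖ * ‖x‖ * ‖y‖ := by ring)

theorem pairing_apply (A : X →L[ℂ] H) (B : Y →L[ℂ] H) (x : X) (y : Y) :
    pairing A B x y = inner ℂ (B y) (A x) := rfl

end Pairing

namespace DeRham

variable {Ω : Set E3} (C : DeRham Ω)

/-- `(u, p) ↦ u`. -/
def trialU : C.Trial →L[ℂ] L2V Ω :=
  DomInter.incl C.d2 C.dstar2 ∘L ContinuousLinearMap.fst ℂ C.V2V2star C.V3starPerp

/-- `(u, p) ↦ d u`. -/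
def trialDU : C.Trial →L[ℂ] L2S Ω :=
  DomInter.fst C.d2 C.dstar2 ∘L ContinuousLinearMap.fst ℂ C.V2V2star C.V3starPerp

/-- `(u, p) ↦ d* u`. -/
def trialDstarU : C.Trial →L[ℂ] L2V Ω :=
  DomInter.snd C.d2 C.dstar2 ∘L ContinuousLinearMap.fst ℂ C.V2V2star C.V3starPerp

/-- `(u, p) ↦ p`. -/
def trialP : C.Trial →L[ℂ] L2S Ω :=
  DomInter.incl (zeroOp (L2S Ω)) C.dstar3 ∘L C.V3starPerp.subtypeL ∘L
    ContinuousLinearMap.snd ℂ C.V2V2star C.V3starPerp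

/-- `(u, p) ↦ d* p`. -/
def trialDstarP : C.Trial →L[ℂ] L2V Ω :=
  DomInter.snd (zeroOp (L2S Ω)) C.dstar3 ∘L C.V3starPerp.subtypeL ∘L
    ContinuousLinearMap.snd ℂ C.V2V2star C.V3starPerp

/-- `(v, q) ↦ v`. -/
def testV : C.TestSpace →L[ℂ] L2V Ω :=
  DomInter.incl (zeroOp (L2V Ω)) C.dstar2 ∘L ContinuousLinearMap.fst ℂ C.V2star C.W3Perp

/-- `(v, q) ↦ d* v`. -/
def testDstarV : C.TestSpace →L[ℂ] L2V Ω :=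
  DomInter.snd (zeroOp (L2V Ω)) C.dstar2 ∘L ContinuousLinearMap.fst ℂ C.V2star C.W3Perp

/-- `(v, q) ↦ q`. -/
def testQ : C.TestSpace →L[ℂ] L2S Ω :=
  C.W3Perp.subtypeL ∘L ContinuousLinearMap.snd ℂ C.V2star C.W3Perp

/-- The extended primal operator
`L̄_lam (u, p) (v, q) = ⟨ν d* u, d* v⟩ + ⟨l₃ d* u + l₅ u - lam d* p, v⟩ + ⟨lam d u, q⟩`. -/
def Lbar (ν lam : ℝ) (l3 l5 : L2V Ω →L[ℂ] L2V Ω) : C.Trial →L[ℂ] C.TestDual :=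
  pairing ((ν : ℂ) • C.trialDstarU) C.testDstarV
    + pairing (l3 ∘L C.trialDstarU + l5 ∘L C.trialU - (lam : ℂ) • C.trialDstarP) C.testV
    + pairing ((lam : ℂ) • C.trialDU) C.testQ

/-- The operator `⟨·, ·⟩ : (u, p) ↦ ((v, q) ↦ ⟨u, v⟩ + ⟨p, q⟩)`. -/
def innerOp : C.Trial →L[ℂ] C.TestDual :=
  pairing C.trialU C.testV + pairing C.trialP C.testQ

end DeRham

end FluidComplex

end

/-!
The pairing `⟨·, ·⟩` is a compact operator, so once `L̄_lam + γ₀ ⟨·, ·⟩` is invertible for a single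
`γ₀`, invertibility fails at `γ` only if `(γ₀ - γ)⁻¹` is an eigenvalue of the fixed compact operator
`(L̄_lam + γ₀ ⟨·, ·⟩)⁻¹ ⟨·, ·⟩`, and a compact operator has at most countably many eigenvalues.

For large real `γ`, the second equation `lam d u + γ p = g` expresses `p` through `u`, and inserting
this in the first one with test functions in `V² ∩ V₂*` leaves a form in `u` which the term
`(lam² / γ) ⟨d u, d v⟩` makes coercive for the norm `‖u‖ + ‖d u‖ + ‖d* u‖`; Lax–Milgram yields `u`.
It remains to see that `p` lies in `V₃*` and that the first equation holds for all `v` in `V₂*`.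
Both follow by subtracting from `v` its projection onto `ker d`: this preserves `d v`, and the
result lies in `(ker d)ᗮ ⊆ ker d*`, on which the graph norm of `d*` is the `L²` norm.
-/

namespace FluidComplex

/-! ### Compact perturbations -/

theorem isInvertible_of_bijective {𝕜 X Y : Type*} [NontriviallyNormedField 𝕜]
    [NormedAddCommGroup X] [NormedSpace 𝕜 X] [CompleteSpace X] [NormedAddCommGroup Y]
    [NormedSpace 𝕜 Y] [CompleteSpace Y] {A : X →L[𝕜] Y} (hA : Function.Bijective A) :
    A.IsInvertible :=
  ⟨ContinuousLinearEquiv.ofBijective A (LinearMap.ker_eq_bot.2 hA.1)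
    (LinearMap.range_eq_top.2 hA.2), ContinuousLinearEquiv.coe_ofBijective A _ _⟩

section CompactOperator

open Module.End

variable {𝕜 X : Type*} [NontriviallyNormedField 𝕜] [NormedAddCommGroup X] [NormedSpace 𝕜 X]

theorem exists_bounded_seq_one_le_norm_sub {M : ℕ → Submodule 𝕜 X} (hM : StrictMono M)
    (hM_closed : ∀ n, IsClosed (M n : Set X)) :
    ∃ (r : ℝ) (y : ℕ → X), ∀ n, y n ∈ M (n + 1) ∧ ‖y n‖ ≤ r ∧ ∀ z ∈ M n, 1 ≤ ‖y n - z‖ := by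
  obtain ⟨c, hc⟩ := NormedField.exists_one_lt_norm 𝕜
  have hy (n : ℕ) : ∃ y ∈ M (n + 1), ‖y‖ ≤ ‖c‖ + 1 ∧ ∀ z ∈ M n, 1 ≤ ‖y - z‖ := by
    have hclosed : IsClosed ((M n).comap (M (n + 1)).subtype : Set (M (n + 1))) :=
      (hM_closed n).preimage continuous_subtype_val
    obtain ⟨x, hx, hxn⟩ := SetLike.exists_of_lt (hM n.lt_succ_self)
    obtain ⟨⟨y, hyM⟩, hyr, hyd⟩ :=
      riesz_lemma_of_norm_lt hc (lt_add_one ‖c‖) hclosed ⟨⟨x, hx⟩, hxn⟩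
    exact ⟨y, hyM, hyr, fun z hz => hyd ⟨z, hM.monotone n.le_succ hz⟩ hz⟩
  choose y hy using hy
  exact ⟨_, y, hy⟩

variable {T : X →L[𝕜] X}

theorem exists_lt_norm_map_sub_map_lt (hT : IsCompactOperator T) {r : ℝ} {y : ℕ → X}
    (hy : ∀ n, ‖y n‖ ≤ r) {ε : ℝ} (hε : 0 < ε) : ∃ m n, m < n ∧ ‖T (y n) - T (y m)‖ < ε := by
  obtain ⟨K, hK, hTK⟩ := hT.image_closedBall_subset_compact r
  obtain ⟨_, -, ψ, hψ, hlim⟩ := hK.tendsto_subseq fun n => hTK ⟨y n, by simp [hy n], rfl⟩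
  obtain ⟨N, hN⟩ := Metric.cauchySeq_iff'.1 hlim.cauchySeq ε hε
  exact ⟨ψ N, ψ (N + 1), hψ N.lt_succ_self, by simpa [dist_eq_norm] using hN (N + 1) N.le_succ⟩

theorem exists_norm_lt_of_strictMono_invariant (hT : IsCompactOperator T) {M : ℕ → Submodule 𝕜 X}
    (hM : StrictMono M) (hM_closed : ∀ n, IsClosed (M n : Set X)) {μ : ℕ → 𝕜}
    (hTM : ∀ n, ∀ y ∈ M n, T y ∈ M n) (hμM : ∀ n, ∀ y ∈ M (n + 1), T y - μ n • y ∈ M n)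
    {ε : ℝ} (hε : 0 < ε) : ∃ n, ‖μ n‖ < ε := by
  by_contra! hμ
  obtain ⟨r, y, hy⟩ := exists_bounded_seq_one_le_norm_sub hM hM_closed
  obtain ⟨m, n, hmn, hlt⟩ := exists_lt_norm_map_sub_map_lt hT (fun n => (hy n).2.1) hε
  have hμ0 : μ n ≠ 0 := norm_pos_iff.1 (hε.trans_le (hμ n))
  -- The distance of `T (y n)` to `M n` is at least `|μ n|`, so the images cannot accumulate.
  let z : X := (μ n)⁻¹ • (T (y m) - (T (y n) - μ n • y n))
  have hTym : T (y m) ∈ M n := hTM n _ (hM.monotone (Nat.succ_le_of_lt hmn) (hy m).1)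
  have hz : z ∈ M n := (M n).smul_mem _ ((M n).sub_mem hTym (hμM n _ (hy n).1))
  have hTz : T (y n) - T (y m) = μ n • (y n - z) := by
    rw [smul_sub, smul_inv_smul₀ hμ0]
    abel
  refine hlt.not_ge ?_
  calc ε ≤ ‖μ n‖ := hμ n
    _ ≤ ‖μ n‖ * ‖y n - z‖ := le_mul_of_one_le_right (norm_nonneg _) ((hy n).2.2 z hz)
    _ = ‖T (y n) - T (y m)‖ := by rw [hTz, norm_smul]

theorem isInvertible_one_add_smul_of_not_hasEigenvalue [CompleteSpace X]
    (hT : IsCompactOperator T) {c : 𝕜}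
    (hc : ¬HasEigenvalue (T : Module.End 𝕜 X) (-c⁻¹)) : (1 + c • T).IsInvertible := by
  rcases eq_or_ne c 0 with rfl | hc0
  · exact ⟨ContinuousLinearEquiv.refl 𝕜 X, by ext; simp⟩
  have hres : IsUnit (algebraMap 𝕜 (X →L[𝕜] X) (-c⁻¹) - T) :=
    (hT.hasEigenvalue_or_mem_resolventSet (by simpa)).resolve_left hc
  have hfactor : 1 + c • T = Units.mk0 (-c) (neg_ne_zero.2 hc0) •
      (algebraMap 𝕜 (X →L[𝕜] X) (-c⁻¹) - T) := by
    rw [Units.smul_mk0, smul_sub, Algebra.algebraMap_eq_smul_one, smul_smul, neg_mul_neg,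
      mul_inv_cancel₀ hc0, one_smul, neg_smul, sub_neg_eq_add]
  obtain ⟨w, hw⟩ := hres.smul (Units.mk0 (-c) (neg_ne_zero.2 hc0))
  exact ⟨ContinuousLinearEquiv.unitsEquiv 𝕜 X w, hw.trans hfactor.symm⟩

variable [CompleteSpace 𝕜]

theorem finite_setOf_hasEigenvalue_le_norm (hT : IsCompactOperator T) {ε : ℝ} (hε : 0 < ε) :
    {μ : 𝕜 | HasEigenvalue (T : Module.End 𝕜 X) μ ∧ ε ≤ ‖μ‖}.Finite := by
  by_contra hinf
  let μ := Set.Infinite.natEmbedding _ hinf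
  choose v hv using fun n => (μ n).2.1.exists_hasEigenvector
  have hTv (n : ℕ) : T (v n) = (μ n : 𝕜) • v n := (hv n).apply_eq_smul
  have hli : LinearIndependent 𝕜 v :=
    eigenvectors_linearIndependent' _ _ (Subtype.val_injective.comp μ.injective) v hv
  let M (n : ℕ) : Submodule 𝕜 X := Submodule.span 𝕜 (v '' Set.Iio n)
  have hvM {i n : ℕ} (h : i < n) : v i ∈ M n := Submodule.subset_span ⟨i, h, rfl⟩
  have hM : StrictMono M := strictMono_nat_of_lt_succ fun n => by
    refine SetLike.lt_iff_le_and_exists.2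
      ⟨Submodule.span_mono (Set.image_mono (Set.Iio_subset_Iio n.le_succ)), v n,
        hvM n.lt_succ_self, hli.notMem_span_image (by simp)⟩
  have hM_closed (n : ℕ) : IsClosed (M n : Set X) := by
    have : FiniteDimensional 𝕜 (M n) :=
      FiniteDimensional.span_of_finite 𝕜 ((Set.finite_Iio n).image v)
    exact (M n).closed_of_finiteDimensional
  have hTM (n : ℕ) : M n ≤ (M n).comap (T : X →ₗ[𝕜] X) := by
    refine Submodule.span_le.2 ?_
    rintro _ ⟨i, hi, rfl⟩
    simpa [hTv] using (M n).smul_mem _ (hvM hi)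
  have hμM (n : ℕ) : M (n + 1) ≤ (M n).comap ((T : X →ₗ[𝕜] X) - (μ n : 𝕜) • LinearMap.id) := by
    refine Submodule.span_le.2 ?_
    rintro _ ⟨i, hi, rfl⟩
    rcases Nat.lt_succ_iff_lt_or_eq.1 hi with h | rfl
    · simpa [hTv, ← sub_smul] using (M n).smul_mem _ (hvM h)
    · simp [hTv]
  obtain ⟨n, hn⟩ := exists_norm_lt_of_strictMono_invariant hT hM hM_closed
    (fun n _ hy => hTM n hy) (μ := fun n => μ n) (fun n _ hy => hμM n hy) hε
  exact hn.not_ge (μ n).2.2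

theorem countable_setOf_hasEigenvalue (hT : IsCompactOperator T) :
    {μ : 𝕜 | HasEigenvalue (T : Module.End 𝕜 X) μ}.Countable := by
  have hsub : {μ : 𝕜 | HasEigenvalue (T : Module.End 𝕜 X) μ} ⊆ insert 0
      (⋃ n : ℕ, {μ | HasEigenvalue (T : Module.End 𝕜 X) μ ∧ 1 / ((n : ℝ) + 1) ≤ ‖μ‖}) := by
    intro μ hμ
    rcases eq_or_ne μ 0 with rfl | h0
    · exact Set.mem_insert _ _
    · obtain ⟨n, hn⟩ := exists_nat_one_div_lt (norm_pos_iff.2 h0)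
      exact Set.mem_insert_of_mem _ (Set.mem_iUnion.2 ⟨n, hμ, hn.le⟩)
  refine (Set.Countable.insert _ (Set.countable_iUnion fun n => ?_)).mono hsub
  exact (finite_setOf_hasEigenvalue_le_norm hT (by positivity)).countable

theorem countable_setOf_not_isInvertible_add_smul [CompleteSpace X] {Y : Type*}
    [NormedAddCommGroup Y] [NormedSpace 𝕜 Y] {A K : X →L[𝕜] Y} (hK : IsCompactOperator K) {γ₀ : 𝕜}
    (h₀ : (A + γ₀ • K).IsInvertible) : {γ : 𝕜 | ¬(A + γ • K).IsInvertible}.Countable := by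
  obtain ⟨e, he⟩ := h₀
  let T : X →L[𝕜] X := (e.symm : Y →L[𝕜] X) ∘L K
  have hT : IsCompactOperator T := hK.clm_comp (e.symm : Y →L[𝕜] X)
  have hfactor (γ : 𝕜) : A + γ • K = (e : X →L[𝕜] Y) ∘L (1 + (γ - γ₀) • T) := by
    have heT : (e : X →L[𝕜] Y) ∘L T = K := by ext; simp [T]
    rw [ContinuousLinearMap.comp_add, ContinuousLinearMap.comp_smul, heT, he]
    ext x
    simp [sub_smul]
  refine ((countable_setOf_hasEigenvalue hT).image fun μ => γ₀ - μ⁻¹).mono fun γ hγ => ?_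
  refine ⟨-(γ - γ₀)⁻¹, not_not.1 fun h => hγ ?_, by simp [inv_neg]⟩
  rw [hfactor, ContinuousLinearMap.isInvertible_equiv_comp]
  exact isInvertible_one_add_smul_of_not_hasEigenvalue hT h

end CompactOperator

/-! ### Coercive forms -/

section LaxMilgram

variable {𝕜 X H : Type*} [RCLike 𝕜] [NormedAddCommGroup X] [NormedSpace 𝕜 X]
  [NormedAddCommGroup H] [InnerProductSpace 𝕜 H] [CompleteSpace H]

theorem exists_forall_inner_eq (f : H →L⋆[𝕜] 𝕜) : ∃ w, ∀ v, inner 𝕜 v w = f v := by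
  let f' : StrongDual 𝕜 H := ((starL 𝕜 : 𝕜 ≃L⋆[𝕜] 𝕜) : 𝕜 →L⋆[𝕜] 𝕜).comp f
  refine ⟨(InnerProductSpace.toDual 𝕜 H).symm f', fun v => ?_⟩
  rw [← inner_conj_symm, InnerProductSpace.toDual_symm_apply]
  exact star_star (f v)

theorem exists_eq_of_coercive (e : X ≃L[𝕜] H) (a : X →L[𝕜] X →L⋆[𝕜] 𝕜) {c : ℝ} (hc : 0 < c)
    (ha : ∀ u, c * ‖u‖ ^ 2 ≤ ‖a u u‖) (f : X →L⋆[𝕜] 𝕜) : ∃ u, a u = f := by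
  let e' : H →L[𝕜] X := e.symm
  let B : H →L⋆[𝕜] H →L[𝕜] 𝕜 := (a.bilinearComp e' e').flip
  let A : H →L[𝕜] H := InnerProductSpace.continuousLinearMapOfBilin B
  have hA (x y : H) : inner 𝕜 (A x) y = a (e.symm y) (e.symm x) :=
    InnerProductSpace.continuousLinearMapOfBilin_apply B x y
  obtain ⟨k, hk, hek⟩ := (e : X →L[𝕜] H).isBoundedLinearMap.bound
  have hcoercive (x : H) : ‖x‖ ^ 2 * (c / k ^ 2) ≤ ‖inner 𝕜 (A x) x‖ := by
    have hx : ‖x‖ ≤ k * ‖e.symm x‖ := by simpa using hek (e.symm x)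
    calc ‖x‖ ^ 2 * (c / k ^ 2) ≤ (k * ‖e.symm x‖) ^ 2 * (c / k ^ 2) := by gcongr
      _ = c * ‖e.symm x‖ ^ 2 := by field_simp
      _ ≤ ‖inner 𝕜 (A x) x‖ := by rw [hA]; exact ha _
  have hunit : IsUnit A := ContinuousLinearMap.isUnit_of_forall_le_norm_inner_map A
    (c := ⟨c / k ^ 2, by positivity⟩) (by exact div_pos hc (by positivity)) hcoercive
  obtain ⟨A', hA'⟩ := hunit.exists_left_inv
  obtain ⟨w, hw⟩ := exists_forall_inner_eq ((f.comp e').comp A')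
  refine ⟨e.symm w, ContinuousLinearMap.ext fun v => ?_⟩
  calc a (e.symm w) v = inner 𝕜 (A (e v)) w := by rw [hA, e.symm_apply_apply]
    _ = f (e.symm (A' (A (e v)))) := hw _
    _ = f v := by
      rw [← mul_apply_eq_comp A' A, hA', one_apply_eq_self, e.symm_apply_apply]

end LaxMilgram

/-! ### Graph norms -/

theorem isClosed_zero {𝕜 F G : Type*} [CommRing 𝕜] [AddCommGroup F] [Module 𝕜 F]
    [TopologicalSpace F] [AddCommGroup G] [Module 𝕜 G] [TopologicalSpace G] [T1Space G] :
    (0 : F →ₗ.[𝕜] G).IsClosed := by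
  have h : ((0 : F →ₗ.[𝕜] G).graph : Set (F × G)) = {z | z.2 = 0} := by
    ext ⟨x, y⟩
    simp only [SetLike.mem_coe, LinearPMap.mem_graph_iff, Set.mem_ofPred_eq]
    exact ⟨fun ⟨a, _, h⟩ => h.symm, fun h => ⟨⟨x, trivial⟩, rfl, h.symm⟩⟩
  rw [LinearPMap.IsClosed, h]
  exact isClosed_singleton.preimage continuous_snd

namespace DomInter

variable {H F G : Type*} [NormedAddCommGroup H] [InnerProductSpace ℂ H]
  [NormedAddCommGroup F] [InnerProductSpace ℂ F]
  [NormedAddCommGroup G] [InnerProductSpace ℂ G]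
  (S : H →ₗ.[ℂ] F) (T : H →ₗ.[ℂ] G)

theorem norm_eq (x : DomInter S T) : ‖x‖ = ‖incl S T x‖ + ‖fst S T x‖ + ‖snd S T x‖ := rfl

theorem incl_mem_fst (x : DomInter S T) : incl S T x ∈ S.domain := x.2.1

theorem incl_mem_snd (x : DomInter S T) : incl S T x ∈ T.domain := x.2.2

theorem incl_injective : Function.Injective (incl S T) := Subtype.val_injective

variable {S T} in
theorem exists_of_mem_graph {x : H} {y : F} {z : G} (hS : (x, y) ∈ S.graph)
    (hT : (x, z) ∈ T.graph) :
    ∃ w : DomInter S T, incl S T w = x ∧ fst S T w = y ∧ snd S T w = z := by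
  obtain ⟨⟨a, ha⟩, rfl, rfl⟩ := (LinearPMap.mem_graph_iff _).1 hS
  obtain ⟨⟨b, hb⟩, h, rfl⟩ := (LinearPMap.mem_graph_iff _).1 hT
  obtain rfl : b = a := h
  exact ⟨⟨b, ha, hb⟩, rfl, rfl, rfl⟩

/-- The embedding `x ↦ (x, S x, T x)`, with the `ℓ²` product norm so as to land in an inner
product space. -/
noncomputable def graphMap : DomInter S T →L[ℂ] WithLp 2 (H × WithLp 2 (F × G)) :=
  (WithLp.prodContinuousLinearEquiv 2 ℂ H (WithLp 2 (F × G))).symm.toContinuousLinearMap ∘L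
    (incl S T).prod ((WithLp.prodContinuousLinearEquiv 2 ℂ F G).symm.toContinuousLinearMap ∘L
      (fst S T).prod (snd S T))

theorem antilipschitzWith_graphMap : AntilipschitzWith 3 (graphMap S T) := by
  refine ContinuousLinearMap.antilipschitz_of_bound _ fun x => ?_
  have h1 : ‖incl S T x‖ ≤ ‖graphMap S T x‖ := WithLp.norm_fst_le _ (graphMap S T x)
  have h2 : ‖fst S T x‖ ≤ ‖graphMap S T x‖ :=
    (WithLp.norm_fst_le _ (graphMap S T x).snd).trans (WithLp.norm_snd_le _ (graphMap S T x))
  have h3 : ‖snd S T x‖ ≤ ‖graphMap S T x‖ :=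
    (WithLp.norm_snd_le _ (graphMap S T x).snd).trans (WithLp.norm_snd_le _ (graphMap S T x))
  calc ‖x‖ = ‖incl S T x‖ + ‖fst S T x‖ + ‖snd S T x‖ := rfl
    _ ≤ ‖graphMap S T x‖ + ‖graphMap S T x‖ + ‖graphMap S T x‖ := by gcongr
    _ = 3 * ‖graphMap S T x‖ := by ring

variable {S T}

theorem isClosed_range_graphMap (hS : S.IsClosed) (hT : T.IsClosed) :
    IsClosed (Set.range (graphMap S T)) := by
  have h : Set.range (graphMap S T) =
      {z | (z.fst, z.snd.fst) ∈ S.graph} ∩ {z | (z.fst, z.snd.snd) ∈ T.graph} := by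
    ext z
    constructor
    · rintro ⟨x, rfl⟩
      exact ⟨S.mem_graph ⟨_, incl_mem_fst S T x⟩, T.mem_graph ⟨_, incl_mem_snd S T x⟩⟩
    · rintro ⟨hzS, hzT⟩
      obtain ⟨x, h1, h2, h3⟩ := exists_of_mem_graph hzS hzT
      exact ⟨x, WithLp.ofLp_injective 2 (Prod.ext h1 (WithLp.ofLp_injective 2 (Prod.ext h2 h3)))⟩
  rw [h]
  exact (IsClosed.preimage (by fun_prop) hS).inter (IsClosed.preimage (by fun_prop) hT)

variable [CompleteSpace H] [CompleteSpace F] [CompleteSpace G]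

theorem completeSpace (hS : S.IsClosed) (hT : T.IsClosed) : CompleteSpace (DomInter S T) := by
  rw [completeSpace_iff_isComplete_range
    ((antilipschitzWith_graphMap S T).isUniformInducing (graphMap S T).uniformContinuous)]
  exact (isClosed_range_graphMap hS hT).isComplete

theorem exists_eq_of_coercive (hS : S.IsClosed) (hT : T.IsClosed)
    (a : DomInter S T →L[ℂ] DomInter S T →L⋆[ℂ] ℂ) {c : ℝ} (hc : 0 < c)
    (ha : ∀ u, c * ‖u‖ ^ 2 ≤ ‖a u u‖) (f : DomInter S T →L⋆[ℂ] ℂ) : ∃ u, a u = f := by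
  have := completeSpace hS hT
  have hclosed := isClosed_range_graphMap hS hT
  have : CompleteSpace (graphMap S T).toLinearMap.range :=
    completeSpace_coe_iff_isComplete.2 hclosed.isComplete
  let e := (graphMap S T).equivRange (antilipschitzWith_graphMap S T).injective hclosed
  exact FluidComplex.exists_eq_of_coercive (H := (graphMap S T).toLinearMap.range) e a hc ha f

end DomInter

/-! ### Kernels and adjoints of unbounded operators -/

section Kernel

variable {𝕜 F G : Type*} [CommRing 𝕜] [AddCommGroup F] [Module 𝕜 F] [AddCommGroup G] [Module 𝕜 G]

/-- The kernel of an unbounded operator as a subspace of the ambient space, encoded as the slice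
of the graph at `0` so that membership includes membership in the domain. -/
def kernel (S : F →ₗ.[𝕜] G) : Submodule 𝕜 F := S.graph.comap (LinearMap.inl 𝕜 F G)

theorem mem_kernel {S : F →ₗ.[𝕜] G} {x : F} : x ∈ kernel S ↔ (x, (0 : G)) ∈ S.graph := Iff.rfl

theorem isClosed_kernel [TopologicalSpace F] [TopologicalSpace G] {S : F →ₗ.[𝕜] G}
    (hS : S.IsClosed) : IsClosed (kernel S : Set F) :=
  IsClosed.preimage (f := fun x : F => (x, (0 : G))) (by fun_prop) hS

end Kernel

theorem orthogonal_kernel_le_kernel_adjoint {𝕜 E F G : Type*} [RCLike 𝕜] [NormedAddCommGroup E]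
    [InnerProductSpace 𝕜 E] [CompleteSpace E] [NormedAddCommGroup F] [InnerProductSpace 𝕜 F]
    [AddCommGroup G] [Module 𝕜 G] {T : E →ₗ.[𝕜] F} {S : F →ₗ.[𝕜] G}
    (hT : Dense (T.domain : Set E)) (hST : ∀ x : T.domain, T x ∈ kernel S) :
    (kernel S)ᗮ ≤ kernel T.adjoint := by
  intro y hy
  have h (x : T.domain) : inner 𝕜 (0 : E) (x : E) = inner 𝕜 y (T x) := by
    rw [inner_zero_left, Submodule.inner_left_of_mem_orthogonal (hST x) hy]
  exact mem_kernel.2 ((LinearPMap.mem_graph_iff _).2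
    ⟨⟨y, LinearPMap.mem_adjoint_domain_of_exists y ⟨0, h⟩⟩, rfl,
      LinearPMap.adjoint_apply_eq hT _ h⟩)

open DomInter

section HilbertComplex

variable {E F G : Type*} [NormedAddCommGroup E] [InnerProductSpace ℂ E]
  [NormedAddCommGroup F] [InnerProductSpace ℂ F] [NormedAddCommGroup G] [InnerProductSpace ℂ G]

/-- The domain of an unbounded operator `R` with its graph norm `‖x‖ + ‖R x‖`. -/
abbrev GraphDomain (R : F →ₗ.[ℂ] E) : Type _ := DomInter (DeRham.zeroOp F) R

theorem GraphDomain.norm_eq (R : F →ₗ.[ℂ] E) (x : GraphDomain R) :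
    ‖x‖ = ‖incl _ R x‖ + ‖snd _ R x‖ := by
  have h : ‖fst _ R x‖ = 0 := norm_zero
  rw [DomInter.norm_eq, h, add_zero]

variable (S : F →ₗ.[ℂ] G) (R : F →ₗ.[ℂ] E)

/-- The bounded inclusion `dom S ∩ dom R → dom R` of graph spaces. -/
noncomputable def toGraphDomain : DomInter S R →L[ℂ] GraphDomain R :=
  LinearMap.mkContinuous
    (Submodule.inclusion (inf_le_inf_right R.domain le_top) : DomInter S R →ₗ[ℂ] GraphDomain R) 1
    fun x => by
      rw [one_mul, GraphDomain.norm_eq, DomInter.norm_eq]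
      exact add_le_add_left (le_add_of_nonneg_right (norm_nonneg _)) _

theorem incl_toGraphDomain (x : DomInter S R) : incl _ R (toGraphDomain S R x) = incl S R x := rfl

theorem snd_toGraphDomain (x : DomInter S R) : snd _ R (toGraphDomain S R x) = snd S R x := rfl

variable {S R}

/-- A subspace of `ker R`, boundedly included in `dom R`. -/
noncomputable def inclOfLeKernel {K : Submodule ℂ F} (hK : K ≤ kernel R) :
    K →L[ℂ] GraphDomain R :=
  LinearMap.mkContinuous
    (Submodule.inclusion (le_inf le_top fun _ hx => LinearPMap.mem_domain_of_mem_graph (hK hx)) :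
      K →ₗ[ℂ] GraphDomain R) 1
    fun x => by
      have h : R ⟨x, LinearPMap.mem_domain_of_mem_graph (hK x.2)⟩ = 0 :=
        ((LinearPMap.image_iff _).2 (mem_kernel.1 (hK x.2))).symm
      rw [one_mul, GraphDomain.norm_eq]
      exact (congrArg (‖(x : F)‖ + ‖·‖) h).le.trans (by simp)

variable [CompleteSpace F]

/-- The orthogonal projection onto `(ker S)ᗮ` as a map into `dom R`, defined when `R` vanishes on
`(ker S)ᗮ`. -/
noncomputable def perpProj (hSR : (kernel S)ᗮ ≤ kernel R) : F →L[ℂ] GraphDomain R :=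
  inclOfLeKernel hSR ∘L (kernel S)ᗮ.orthogonalProjectionOnto

theorem incl_perpProj [(kernel S).HasOrthogonalProjection] (hSR : (kernel S)ᗮ ≤ kernel R)
    (x : F) : incl _ R (perpProj hSR x) = x - (kernel S).starProjection x := by
  rw [← Submodule.starProjection_orthogonal_val]
  rfl

theorem exists_toGraphDomain_eq_perpProj (hS : S.IsClosed) (hSR : (kernel S)ᗮ ≤ kernel R)
    {x : F} {y : G} (hxy : (x, y) ∈ S.graph) :
    ∃ v : DomInter S R, fst S R v = y ∧ toGraphDomain S R v = perpProj hSR x := by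
  have : CompleteSpace (kernel S) := (isClosed_kernel hS).completeSpace_coe
  have hproj : ((kernel S).starProjection x, (0 : G)) ∈ S.graph :=
    mem_kernel.1 (Submodule.starProjection_apply_mem _ _)
  have hgraph : (incl _ R (perpProj hSR x), y) ∈ S.graph := by
    simpa [incl_perpProj] using S.graph.sub_mem hxy hproj
  obtain ⟨v, hv, hv', -⟩ := exists_of_mem_graph hgraph
    (mem_kernel.1 (hSR ((kernel S)ᗮ.orthogonalProjectionOnto x).2))
  exact ⟨v, hv', incl_injective _ _ hv⟩

theorem denseRange_toGraphDomain (hS_dense : Dense (S.domain : Set F)) (hS : S.IsClosed)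
    (hSR : (kernel S)ᗮ ≤ kernel R) : DenseRange (toGraphDomain S R) := by
  have : CompleteSpace (kernel S) := (isClosed_kernel hS).completeSpace_coe
  let M : Submodule ℂ (GraphDomain R) := (toGraphDomain S R).toLinearMap.range.topologicalClosure
  have hperp (x : F) : perpProj hSR x ∈ M := by
    refine hS_dense.induction (fun y hy => ?_)
      ((Submodule.isClosed_topologicalClosure _).preimage (perpProj hSR).continuous) x
    obtain ⟨v, -, hv⟩ := exists_toGraphDomain_eq_perpProj hS hSR (S.mem_graph ⟨y, hy⟩)
    exact subset_closure ⟨v, hv⟩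
  intro z
  let x : F := incl _ R z
  have hker : (kernel S).starProjection x ∈ kernel S := Submodule.starProjection_apply_mem _ _
  have hdiff : incl _ R (z - perpProj hSR x) = (kernel S).starProjection x := by
    rw [map_sub, incl_perpProj, sub_sub_cancel]
  obtain ⟨v, hv, -⟩ := exists_of_mem_graph (mem_kernel.1 hker)
    (R.mem_graph ⟨_, hdiff ▸ incl_mem_snd _ R (z - perpProj hSR x)⟩)
  have hz : z = toGraphDomain S R v + perpProj hSR x :=
    sub_eq_iff_eq_add.1 (incl_injective _ _ (hdiff.trans hv.symm))
  rw [hz]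
  exact M.add_mem (subset_closure ⟨v, rfl⟩) (hperp x)

theorem inner_incl_snd_adjoint (hS : Dense (S.domain : Set F)) (v : DomInter S R)
    (p : GraphDomain S.adjoint) :
    inner ℂ (incl S R v) (snd _ _ p) = inner ℂ (fst S R v) (incl _ _ p) :=
  ((LinearPMap.adjoint_isFormalAdjoint hS).symm ⟨_, incl_mem_fst S R v⟩
    ⟨_, incl_mem_snd _ _ p⟩).symm

theorem exists_adjoint_of_forall_toGraphDomain (hS_dense : Dense (S.domain : Set F))
    (hS : S.IsClosed) (hSR : (kernel S)ᗮ ≤ kernel R) {h : GraphDomain R →L⋆[ℂ] ℂ} {q : G}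
    (hq : ∀ v, h (toGraphDomain S R v) = inner ℂ (fst S R v) q) :
    ∃ p : GraphDomain S.adjoint, incl _ _ p = q ∧
      ∀ v, h v = inner ℂ (incl _ R v) (snd _ _ p) := by
  -- Projecting off `ker S` does not change `S x`, so `x ↦ ⟨q, S x⟩` is bounded via `h ∘ perpProj`.
  have hq_mem : q ∈ S.adjoint.domain := by
    have hinner (x : S.domain) : inner ℂ q (S x) = starRingEnd ℂ (h (perpProj hSR x)) := by
      obtain ⟨v, hv, hv'⟩ := exists_toGraphDomain_eq_perpProj hS hSR (S.mem_graph x)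
      rw [← hv', hq, hv, inner_conj_symm]
    rw [LinearPMap.mem_adjoint_domain_iff]
    exact Continuous.congr (by fun_prop) fun x => (hinner x).symm
  obtain ⟨p, hp, -⟩ := exists_of_mem_graph ((DeRham.zeroOp G).mem_graph ⟨q, trivial⟩)
    (S.adjoint.mem_graph ⟨q, hq_mem⟩)
  refine ⟨p, hp, congrFun ((denseRange_toGraphDomain hS_dense hS hSR).equalizer
    h.continuous (by fun_prop) (funext fun v => ?_))⟩
  simp only [Function.comp_apply]
  rw [hq, incl_toGraphDomain, inner_incl_snd_adjoint hS_dense, hp]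

end HilbertComplex

/-! ### The saddle point problem -/

section SesquilinearForms

variable {E F G : Type*} [NormedAddCommGroup E] [InnerProductSpace ℂ E]
  [NormedAddCommGroup F] [InnerProductSpace ℂ F] [NormedAddCommGroup G] [InnerProductSpace ℂ G]
  (S : F →ₗ.[ℂ] G) (R : F →ₗ.[ℂ] E) (ν γ κ : ℝ) (l3 : E →L[ℂ] F) (l5 : F →L[ℂ] F)

/-- The velocity part `⟨ν R u, R v⟩ + ⟨l₃ R u + l₅ u + γ u, v⟩` of the shifted saddle point
operator, where `u` ranges over `dom S ∩ dom R` and `v` over `dom R`. -/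
noncomputable def momentumForm : DomInter S R →L[ℂ] GraphDomain R →L⋆[ℂ] ℂ :=
  pairing ((ν : ℂ) • snd S R) (snd _ R) +
    pairing (l3 ∘L snd S R + l5 ∘L incl S R + (γ : ℂ) • incl S R) (incl _ R)

/-- The momentum form after elimination of the pressure, which contributes the term
`κ ⟨S u, S v⟩`. -/
noncomputable def reducedForm : DomInter S R →L[ℂ] DomInter S R →L⋆[ℂ] ℂ :=
  pairing ((ν : ℂ) • snd S R) (snd S R) +
    pairing (l3 ∘L snd S R + l5 ∘L incl S R + (γ : ℂ) • incl S R) (incl S R) +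
    pairing ((κ : ℂ) • fst S R) (fst S R)

theorem momentumForm_apply (u : DomInter S R) (v : GraphDomain R) :
    momentumForm S R ν γ l3 l5 u v = inner ℂ (snd _ R v) ((ν : ℂ) • snd S R u) +
      inner ℂ (incl _ R v) (l3 (snd S R u) + l5 (incl S R u) + (γ : ℂ) • incl S R u) := rfl

theorem reducedForm_apply (u v : DomInter S R) : reducedForm S R ν γ κ l3 l5 u v =
    momentumForm S R ν γ l3 l5 u (toGraphDomain S R v) + κ * inner ℂ (fst S R v) (fst S R u) := by
  rw [← inner_smul_right]
  rfl

variable {ν γ κ}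

theorem re_ofReal_mul_inner_self {W : Type*} [NormedAddCommGroup W] [InnerProductSpace ℂ W]
    (r : ℝ) (x : W) : (r * inner ℂ x x : ℂ).re = r * ‖x‖ ^ 2 := by
  rw [inner_self_eq_norm_sq_to_K, Complex.re_ofReal_mul]
  norm_cast

theorem le_re_inner_clm_apply {V W : Type*} [NormedAddCommGroup V] [NormedSpace ℂ V]
    [NormedAddCommGroup W] [InnerProductSpace ℂ W] (A : V →L[ℂ] W) (x : W) (y : V) :
    -(‖A‖ * ‖y‖ * ‖x‖) ≤ (inner ℂ x (A y)).re := by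
  refine neg_le_of_abs_le ((Complex.abs_re_le_norm _).trans ((norm_inner_le_norm _ _).trans ?_))
  rw [mul_comm]
  gcongr
  exact A.le_opNorm y

theorem le_re_momentumForm (hν : 0 < ν) (u : DomInter S R) :
    ν / 2 * ‖snd S R u‖ ^ 2 + (γ - (‖l5‖ + ‖l3‖ ^ 2 / (2 * ν))) * ‖incl S R u‖ ^ 2 ≤
      (momentumForm S R ν γ l3 l5 u (toGraphDomain S R u)).re := by
  have hyoung : ‖l3‖ * ‖snd S R u‖ * ‖incl S R u‖ ≤
      ν / 2 * ‖snd S R u‖ ^ 2 + ‖l3‖ ^ 2 / (2 * ν) * ‖incl S R u‖ ^ 2 := by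
    have hsq : 0 ≤ (ν * ‖snd S R u‖ - ‖l3‖ * ‖incl S R u‖) ^ 2 / (2 * ν) := by positivity
    refine sub_nonneg.1 (hsq.trans_eq ?_)
    field_simp
    ring
  rw [momentumForm_apply, snd_toGraphDomain, incl_toGraphDomain, inner_add_right,
    inner_add_right, Complex.add_re, Complex.add_re, Complex.add_re, inner_smul_right,
    inner_smul_right, re_ofReal_mul_inner_self, re_ofReal_mul_inner_self]
  linarith [le_re_inner_clm_apply l3 (incl S R u) (snd S R u),
    le_re_inner_clm_apply l5 (incl S R u) (incl S R u)]

theorem exists_forall_le_norm_reducedForm (hν : 0 < ν) (hκ : 0 < κ)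
    (hγ : ‖l5‖ + ‖l3‖ ^ 2 / (2 * ν) < γ) :
    ∃ c > 0, ∀ u, c * ‖u‖ ^ 2 ≤ ‖reducedForm S R ν γ κ l3 l5 u u‖ := by
  let δ : ℝ := γ - (‖l5‖ + ‖l3‖ ^ 2 / (2 * ν))
  let m : ℝ := min δ (min κ (ν / 2))
  have : 0 < δ := sub_pos.2 hγ
  have : 0 < m := by positivity
  refine ⟨m / 3, by positivity, fun u => ?_⟩
  calc m / 3 * ‖u‖ ^ 2
      ≤ m / 3 * (3 * (‖incl S R u‖ ^ 2 + ‖fst S R u‖ ^ 2 + ‖snd S R u‖ ^ 2)) := by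
        rw [DomInter.norm_eq]
        gcongr
        nlinarith [sq_nonneg (‖incl S R u‖ - ‖fst S R u‖),
          sq_nonneg (‖fst S R u‖ - ‖snd S R u‖), sq_nonneg (‖incl S R u‖ - ‖snd S R u‖)]
    _ = m * ‖incl S R u‖ ^ 2 + m * ‖fst S R u‖ ^ 2 + m * ‖snd S R u‖ ^ 2 := by ring
    _ ≤ δ * ‖incl S R u‖ ^ 2 + κ * ‖fst S R u‖ ^ 2 + ν / 2 * ‖snd S R u‖ ^ 2 := by
        gcongr
        exacts [min_le_left _ _, (min_le_right _ _).trans (min_le_left _ _),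
          (min_le_right _ _).trans (min_le_right _ _)]
    _ ≤ (reducedForm S R ν γ κ l3 l5 u u).re := by
        rw [reducedForm_apply, Complex.add_re, re_ofReal_mul_inner_self]
        linarith [le_re_momentumForm S R l3 l5 (γ := γ) hν u]
    _ ≤ ‖reducedForm S R ν γ κ l3 l5 u u‖ := Complex.re_le_norm _

end SesquilinearForms

section SaddlePoint

variable {E F G : Type*} [NormedAddCommGroup E] [InnerProductSpace ℂ E]
  [NormedAddCommGroup F] [InnerProductSpace ℂ F] [NormedAddCommGroup G] [InnerProductSpace ℂ G]
  [CompleteSpace F] {S : F →ₗ.[ℂ] G} {R : F →ₗ.[ℂ] E} {ν γ lam : ℝ} {l3 : E →L[ℂ] F}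
  {l5 : F →L[ℂ] F}

theorem exists_saddlePoint [CompleteSpace E] [CompleteSpace G]
    (hS_dense : Dense (S.domain : Set F)) (hS : S.IsClosed) (hR : R.IsClosed)
    (hSR : (kernel S)ᗮ ≤ kernel R) (hν : 0 < ν) (hlam : lam ≠ 0)
    (hγ : ‖l5‖ + ‖l3‖ ^ 2 / (2 * ν) < γ) (f : GraphDomain R →L⋆[ℂ] ℂ) (g : G) :
    ∃ (u : DomInter S R) (p : GraphDomain S.adjoint),
      (∀ v, momentumForm S R ν γ l3 l5 u v - lam * inner ℂ (incl _ R v) (snd _ _ p) = f v) ∧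
        (lam : ℂ) • fst S R u + (γ : ℂ) • incl _ _ p = g := by
  have hγ0 : 0 < γ := lt_of_le_of_lt (by positivity) hγ
  have hγC : (γ : ℂ) ≠ 0 := Complex.ofReal_ne_zero.2 hγ0.ne'
  have hlamC : (lam : ℂ) ≠ 0 := Complex.ofReal_ne_zero.2 hlam
  obtain ⟨c, hc, hcoercive⟩ := exists_forall_le_norm_reducedForm S R l3 l5 hν
    (κ := lam ^ 2 / γ) (by positivity) hγ
  -- Inserting `p = γ⁻¹ (g - lam S u)` into the first equation gives the equation for `u`.
  obtain ⟨u, hu⟩ := DomInter.exists_eq_of_coercive hS hR (reducedForm S R ν γ _ l3 l5) hc hcoercive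
    (f.comp (toGraphDomain S R) +
      pairing (ContinuousLinearMap.id ℂ G) (fst S R) (((lam : ℂ) / γ) • g))
  let q : G := (γ : ℂ)⁻¹ • (g - (lam : ℂ) • fst S R u)
  let h : GraphDomain R →L⋆[ℂ] ℂ := (lam : ℂ)⁻¹ • (momentumForm S R ν γ l3 l5 u - f)
  have hh (v : GraphDomain R) : lam * h v = momentumForm S R ν γ l3 l5 u v - f v :=
    mul_inv_cancel_left₀ hlamC _
  have hq (v : DomInter S R) : h (toGraphDomain S R v) = inner ℂ (fst S R v) q := by
    have huv : reducedForm S R ν γ (lam ^ 2 / γ) l3 l5 u v =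
        f (toGraphDomain S R v) + inner ℂ (fst S R v) (((lam : ℂ) / γ) • g) :=
      DFunLike.congr_fun hu v
    rw [reducedForm_apply, ← sub_eq_iff_eq_add', add_sub_right_comm, ← hh, inner_smul_right] at huv
    refine mul_left_cancel₀ hlamC ?_
    simp only [q, inner_smul_right, inner_sub_right]
    rw [← sub_eq_iff_eq_add.2 huv.symm]
    push_cast
    field_simp
  obtain ⟨p, hp, hadj⟩ := exists_adjoint_of_forall_toGraphDomain hS_dense hS hSR hq
  refine ⟨u, p, fun v => ?_, ?_⟩
  · rw [← hadj, hh, sub_sub_cancel]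
  · rw [hp, smul_inv_smul₀ hγC, add_sub_cancel]

theorem eq_zero_of_saddlePoint_eq_zero (hS_dense : Dense (S.domain : Set F)) (hν : 0 < ν)
    (hlam : lam ≠ 0) (hγ : ‖l5‖ + ‖l3‖ ^ 2 / (2 * ν) < γ) {u : DomInter S R}
    {p : GraphDomain S.adjoint}
    (hu : ∀ v, momentumForm S R ν γ l3 l5 u v - lam * inner ℂ (incl _ R v) (snd _ _ p) = 0)
    (hp : (lam : ℂ) • fst S R u + (γ : ℂ) • incl _ _ p = 0) : u = 0 ∧ p = 0 := by
  have hγ0 : 0 < γ := lt_of_le_of_lt (by positivity) hγ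
  have hγC : (γ : ℂ) ≠ 0 := Complex.ofReal_ne_zero.2 hγ0.ne'
  obtain ⟨c, hc, hcoercive⟩ := exists_forall_le_norm_reducedForm S R l3 l5 hν
    (κ := lam ^ 2 / γ) (by positivity) hγ
  have hpu : incl _ _ p = (-(lam / γ) : ℂ) • fst S R u := by
    rw [← smul_right_inj hγC, eq_neg_of_add_eq_zero_right hp, smul_smul, ← neg_smul]
    field_simp
  have hzero : reducedForm S R ν γ (lam ^ 2 / γ) l3 l5 u u = 0 := by
    rw [reducedForm_apply, ← hu (toGraphDomain S R u), incl_toGraphDomain,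
      inner_incl_snd_adjoint hS_dense, hpu, inner_smul_right]
    push_cast
    ring
  have hu0 : u = 0 := by
    have hnorm := hcoercive u
    rw [hzero, norm_zero] at hnorm
    have hsq : ‖u‖ ^ 2 ≤ 0 := nonpos_of_mul_nonpos_right hnorm hc
    exact norm_eq_zero.1 (pow_eq_zero_iff two_ne_zero |>.1 (hsq.antisymm (sq_nonneg _)))
  refine ⟨hu0, incl_injective _ _ ?_⟩
  rw [hpu, hu0, map_zero, map_zero, smul_zero]

end SaddlePoint

theorem isCompactOperator_pairing {X Y H : Type*} [NormedAddCommGroup X] [NormedSpace ℂ X]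
    [NormedAddCommGroup Y] [NormedSpace ℂ Y] [NormedAddCommGroup H] [InnerProductSpace ℂ H]
    {A : X →L[ℂ] H} (hA : IsCompactOperator A) (B : Y →L[ℂ] H) :
    IsCompactOperator (pairing A B) :=
  hA.clm_comp (pairing (ContinuousLinearMap.id ℂ H) B)

section SaddleOperator

variable {E F G : Type*} [NormedAddCommGroup E] [InnerProductSpace ℂ E]
  [NormedAddCommGroup F] [InnerProductSpace ℂ F] [NormedAddCommGroup G] [InnerProductSpace ℂ G]

/-- The closure of the range of an unbounded operator, encoded as the double orthogonal complement
of its range: the space `(ℌ³)^⊥` of the paper for the divergence. -/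
noncomputable def rangeClosure (S : F →ₗ.[ℂ] G) : Submodule ℂ G := (LinearMap.range S.toFun)ᗮᗮ

theorem fst_mem_rangeClosure (S : F →ₗ.[ℂ] G) (R : F →ₗ.[ℂ] E) (u : DomInter S R) :
    fst S R u ∈ rangeClosure S :=
  (LinearMap.range S.toFun).le_orthogonal_orthogonal (LinearMap.mem_range_self S.toFun _)

theorem isClosed_rangeClosure (S : F →ₗ.[ℂ] G) : IsClosed (rangeClosure S : Set G) :=
  Submodule.isClosed_orthogonal _

variable [CompleteSpace F] (S : F →ₗ.[ℂ] G) (R : F →ₗ.[ℂ] E)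

/-- The space of pressures: the elements of `dom S*` lying in the closure of the range of `S`. -/
noncomputable def PressureSpace : Submodule ℂ (GraphDomain S.adjoint) :=
  (rangeClosure S).comap (inclₗ (DeRham.zeroOp G) S.adjoint)

/-- The pairs `(u, p)` of a velocity in `dom S ∩ dom R` and a pressure. -/
abbrev SaddleTrial : Type _ := DomInter S R × PressureSpace S

/-- The pairs `(v, q)` against which the saddle point equations are tested. -/
abbrev SaddleTest : Type _ := GraphDomain R × rangeClosure S

/-- The saddle point operator
`(u, p) (v, q) ↦ ⟨ν R u, R v⟩ + ⟨l₃ R u + l₅ u - lam S* p, v⟩ + ⟨lam S u, q⟩`, which is `L̄_lam`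
for `S = d` on `V²` and `R = d*` on `V₂*`. -/
noncomputable def saddleOperator (ν lam : ℝ) (l3 : E →L[ℂ] F) (l5 : F →L[ℂ] F) :
    SaddleTrial S R →L[ℂ] SaddleTest S R →L⋆[ℂ] ℂ :=
  let u := incl S R ∘L ContinuousLinearMap.fst ℂ _ (PressureSpace S)
  let Su := fst S R ∘L ContinuousLinearMap.fst ℂ _ (PressureSpace S)
  let Ru := snd S R ∘L ContinuousLinearMap.fst ℂ _ (PressureSpace S)
  let adjp := snd _ S.adjoint ∘L (PressureSpace S).subtypeL ∘L ContinuousLinearMap.snd ℂ _ _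
  let v := incl _ R ∘L ContinuousLinearMap.fst ℂ _ (rangeClosure S)
  let Rv := snd _ R ∘L ContinuousLinearMap.fst ℂ _ (rangeClosure S)
  let q := (rangeClosure S).subtypeL ∘L ContinuousLinearMap.snd ℂ _ _
  pairing ((ν : ℂ) • Ru) Rv + pairing (l3 ∘L Ru + l5 ∘L u - (lam : ℂ) • adjp) v +
    pairing ((lam : ℂ) • Su) q

/-- The operator `(u, p) (v, q) ↦ ⟨u, v⟩ + ⟨p, q⟩` between the spaces of `saddleOperator`. -/
noncomputable def saddlePairing : SaddleTrial S R →L[ℂ] SaddleTest S R →L⋆[ℂ] ℂ :=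
  pairing (incl S R ∘L ContinuousLinearMap.fst ℂ _ (PressureSpace S))
      (incl _ R ∘L ContinuousLinearMap.fst ℂ _ (rangeClosure S)) +
    pairing (incl _ S.adjoint ∘L (PressureSpace S).subtypeL ∘L ContinuousLinearMap.snd ℂ _ _)
      ((rangeClosure S).subtypeL ∘L ContinuousLinearMap.snd ℂ _ _)

variable {S R}

theorem isClosed_pressureSpace : IsClosed (PressureSpace S : Set (GraphDomain S.adjoint)) :=
  (isClosed_rangeClosure S).preimage (incl (DeRham.zeroOp G) S.adjoint).continuous

theorem completeSpace_saddleTrial [CompleteSpace E] [CompleteSpace G]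
    (hS_dense : Dense (S.domain : Set F)) (hS : S.IsClosed) (hR : R.IsClosed) :
    CompleteSpace (SaddleTrial S R) := by
  have : CompleteSpace (DomInter S R) := DomInter.completeSpace hS hR
  have : CompleteSpace (GraphDomain S.adjoint) :=
    DomInter.completeSpace isClosed_zero (LinearPMap.adjoint_isClosed hS_dense)
  have : CompleteSpace (PressureSpace S) := isClosed_pressureSpace.completeSpace_coe
  infer_instance

theorem isCompactOperator_saddlePairing (hu : IsCompactOperator (incl S R))
    (hp : IsCompactOperator (incl (DeRham.zeroOp G) S.adjoint)) :
    IsCompactOperator (saddlePairing S R) :=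
  have hU : IsCompactOperator (incl S R ∘L ContinuousLinearMap.fst ℂ _ (PressureSpace S)) :=
    hu.comp_clm (ContinuousLinearMap.fst ℂ _ (PressureSpace S))
  have hP : IsCompactOperator (incl _ S.adjoint ∘L (PressureSpace S).subtypeL ∘L
      ContinuousLinearMap.snd ℂ (DomInter S R) _) :=
    hp.comp_clm ((PressureSpace S).subtypeL ∘L ContinuousLinearMap.snd ℂ (DomInter S R) _)
  (isCompactOperator_pairing hU _).add (isCompactOperator_pairing hP _)

variable {ν lam γ : ℝ} {l3 : E →L[ℂ] F} {l5 : F →L[ℂ] F}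

theorem saddleOperator_add_smul_saddlePairing_apply (u : DomInter S R) (p : PressureSpace S)
    (v : GraphDomain R) (q : rangeClosure S) :
    (saddleOperator S R ν lam l3 l5 + (γ : ℂ) • saddlePairing S R) (u, p) (v, q) =
      (momentumForm S R ν γ l3 l5 u v - lam * inner ℂ (incl _ R v) (snd _ S.adjoint p.1)) +
        inner ℂ (q : G) ((lam : ℂ) • fst S R u + (γ : ℂ) • incl _ S.adjoint p.1) := by
  have h : (saddleOperator S R ν lam l3 l5 + (γ : ℂ) • saddlePairing S R) (u, p) (v, q) =
      inner ℂ (snd _ R v) ((ν : ℂ) • snd S R u) +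
        inner ℂ (incl _ R v)
          (l3 (snd S R u) + l5 (incl S R u) - (lam : ℂ) • snd _ S.adjoint p.1) +
        inner ℂ (q : G) ((lam : ℂ) • fst S R u) +
        γ * (inner ℂ (incl _ R v) (incl S R u) + inner ℂ (q : G) (incl _ S.adjoint p.1)) := rfl
  rw [h, momentumForm_apply]
  simp only [inner_add_right, inner_sub_right, inner_smul_right]
  ring

theorem injective_saddleOperator_add_smul (hS_dense : Dense (S.domain : Set F)) (hν : 0 < ν)
    (hlam : lam ≠ 0) (hγ : ‖l5‖ + ‖l3‖ ^ 2 / (2 * ν) < γ) :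
    Function.Injective (saddleOperator S R ν lam l3 l5 + (γ : ℂ) • saddlePairing S R) := by
  rw [injective_iff_map_eq_zero]
  rintro ⟨u, p⟩ h
  let r : rangeClosure S := (lam : ℂ) • ⟨fst S R u, fst_mem_rangeClosure S R u⟩ +
    (γ : ℂ) • ⟨incl _ S.adjoint p.1, p.2⟩
  have heq (v : GraphDomain R) (q : rangeClosure S) :
      (momentumForm S R ν γ l3 l5 u v - lam * inner ℂ (incl _ R v) (snd _ S.adjoint p.1)) +
        inner ℂ (q : G) (r : G) = 0 :=
    (saddleOperator_add_smul_saddlePairing_apply u p v q).symm.trans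
      (DFunLike.congr_fun h (v, q))
  have hr : r = 0 := by simpa using heq 0 r
  obtain ⟨rfl, hp⟩ := eq_zero_of_saddlePoint_eq_zero hS_dense hν hlam hγ
    (fun v => by simpa using heq v 0) (congrArg Subtype.val hr)
  exact Prod.ext rfl (Subtype.ext hp)

theorem surjective_saddleOperator_add_smul [CompleteSpace E] [CompleteSpace G]
    (hS_dense : Dense (S.domain : Set F)) (hS : S.IsClosed) (hR : R.IsClosed)
    (hSR : (kernel S)ᗮ ≤ kernel R) (hν : 0 < ν) (hlam : lam ≠ 0)
    (hγ : ‖l5‖ + ‖l3‖ ^ 2 / (2 * ν) < γ) :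
    Function.Surjective (saddleOperator S R ν lam l3 l5 + (γ : ℂ) • saddlePairing S R) := by
  intro φ
  have : CompleteSpace (rangeClosure S) := (isClosed_rangeClosure S).completeSpace_coe
  obtain ⟨g, hg⟩ := exists_forall_inner_eq
    (φ.comp (ContinuousLinearMap.inr ℂ (GraphDomain R) (rangeClosure S)))
  obtain ⟨u, p, hu, hp⟩ := exists_saddlePoint hS_dense hS hR hSR hν hlam hγ
    (φ.comp (ContinuousLinearMap.inl ℂ (GraphDomain R) (rangeClosure S))) (g : G)
  have hγ0 : (γ : ℂ) ≠ 0 := Complex.ofReal_ne_zero.2 (lt_of_le_of_lt (by positivity) hγ).ne'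
  have hp_mem : p ∈ PressureSpace S := by
    refine ((rangeClosure S).smul_mem_iff hγ0).1 ?_
    change (γ : ℂ) • incl _ _ p ∈ rangeClosure S
    rw [eq_sub_of_add_eq' hp]
    exact sub_mem g.2 ((rangeClosure S).smul_mem _ (fst_mem_rangeClosure S R u))
  refine ⟨(u, ⟨p, hp_mem⟩), ContinuousLinearMap.ext fun ⟨v, q⟩ => ?_⟩
  calc (saddleOperator S R ν lam l3 l5 + (γ : ℂ) • saddlePairing S R) (u, ⟨p, hp_mem⟩) (v, q)
      = φ (v, 0) + inner ℂ (q : G) (g : G) := by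
        rw [saddleOperator_add_smul_saddlePairing_apply, hu, hp]
        rfl
    _ = φ (v, 0) + φ (0, q) := congrArg _ (hg q)
    _ = φ (v, q) := by rw [← map_add, Prod.mk_add_mk, add_zero, zero_add]

theorem isInvertible_saddleOperator_add_smul [CompleteSpace E] [CompleteSpace G]
    (hS_dense : Dense (S.domain : Set F)) (hS : S.IsClosed) (hR : R.IsClosed)
    (hSR : (kernel S)ᗮ ≤ kernel R) (hν : 0 < ν) (hlam : lam ≠ 0)
    (hγ : ‖l5‖ + ‖l3‖ ^ 2 / (2 * ν) < γ) :
    (saddleOperator S R ν lam l3 l5 + (γ : ℂ) • saddlePairing S R).IsInvertible := by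
  have := completeSpace_saddleTrial hS_dense hS hR
  exact isInvertible_of_bijective (𝕜 := ℂ) (X := SaddleTrial S R) (Y := SaddleTest S R →L⋆[ℂ] ℂ)
    (A := saddleOperator S R ν lam l3 l5 + (γ : ℂ) • saddlePairing S R)
    ⟨injective_saddleOperator_add_smul hS_dense hν hlam hγ,
      surjective_saddleOperator_add_smul hS_dense hS hR hSR hν hlam hγ⟩

end SaddleOperator

/-! ### The divergence of a curl -/

section WeakDerivatives

variable {Ω : Set E3} {φ : E3 → ℝ}

theorem IsTest.pd (hφ : IsTest Ω φ) (i : Fin 3) : IsTest Ω (pd i φ) :=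
  ⟨(hφ.1.fderiv_right (by simp)).clm_apply contDiff_const, hφ.2.1.fderiv_apply ℝ _,
    (tsupport_fderiv_apply_subset ℝ _).trans hφ.2.2⟩

theorem pd_comm (hφ : ContDiff ℝ 2 φ) (i j : Fin 3) (x : E3) :
    pd i (pd j φ) x = pd j (pd i φ) x := by
  have hd : DifferentiableAt ℝ (fderiv ℝ φ) x :=
    (hφ.fderiv_right (m := 1) (by norm_num)).differentiable one_ne_zero x
  have h (k l : Fin 3) : FluidComplex.pd k (FluidComplex.pd l φ) x =
      fderiv ℝ (fderiv ℝ φ) x (EuclideanSpace.single k 1) (EuclideanSpace.single l 1) := by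
    have hl : FluidComplex.pd l φ = fun y => fderiv ℝ φ y (EuclideanSpace.single l 1) := rfl
    rw [FluidComplex.pd, hl, fderiv_clm_apply hd (by fun_prop)]
    simp
  rw [h, h]
  exact (hφ.contDiffAt.isSymmSndFDerivAt (by simp)) _ _

theorem IsTest.integrable_mul_coord (hφ : IsTest Ω φ) (w : L2V Ω) (i : Fin 3) :
    Integrable (fun x => (φ x : ℂ) * w x i) (volume.restrict Ω) := by
  have hw : MemLp (fun x => w x i) 2 (volume.restrict Ω) :=
    (EuclideanSpace.proj (𝕜 := ℂ) i).comp_memLp' (Lp.memLp w)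
  have hφ_memLp : MemLp (fun x => (φ x : ℂ)) 2 (volume.restrict Ω) :=
    (Complex.continuous_ofReal.comp hφ.1.continuous).memLp_of_hasCompactSupport
      (hφ.2.1.comp_left Complex.ofReal_zero)
  exact hφ_memLp.integrable_mul hw

theorem sum_pd_pd_mul_sub_eq_zero (hφ : ContDiff ℝ 2 φ) (w : Fin 3 → ℂ) (x : E3) :
    ∑ i, ((pd (i + 1) (pd i φ) x : ℂ) * w (i + 2) - (pd (i + 2) (pd i φ) x : ℂ) * w (i + 1)) =
      0 := by
  rw [Finset.sum_sub_distrib, sub_eq_zero]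
  refine Fintype.sum_equiv (Equiv.addRight 1) _ _ fun i => ?_
  have hi : i + 1 + 2 = i := by rw [add_assoc]; exact add_zero i
  rw [Equiv.coe_addRight, hi, pd_comm hφ, add_assoc]
  rfl

theorem HasWeakCurl.integral_mul_eq_zero {u c : L2V Ω} {s : L2S Ω} (hc : HasWeakCurl u c)
    (hs : HasWeakDiv c s) (hφ : IsTest Ω φ) : ∫ x in Ω, (φ x : ℂ) * s x = 0 := by
  have hint (i : Fin 3) : Integrable (fun x => (pd (i + 1) (pd i φ) x : ℂ) * u x (i + 2) -
      (pd (i + 2) (pd i φ) x : ℂ) * u x (i + 1)) (volume.restrict Ω) :=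
    (((hφ.pd i).pd (i + 1)).integrable_mul_coord u (i + 2)).sub
      (((hφ.pd i).pd (i + 2)).integrable_mul_coord u (i + 1))
  have hφ2 : ContDiff ℝ 2 φ := contDiff_infty.1 hφ.1 2
  calc ∫ x in Ω, (φ x : ℂ) * s x
      = -∑ i, ∫ x in Ω, (pd i φ x : ℂ) * c x i := by
        rw [hs φ hφ, integral_finsetSum _ fun i _ => (hφ.pd i).integrable_mul_coord c i]
    _ = ∫ x in Ω, ∑ i, ((pd (i + 1) (pd i φ) x : ℂ) * u x (i + 2) -
          (pd (i + 2) (pd i φ) x : ℂ) * u x (i + 1)) := by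
        simp only [fun i => hc _ (hφ.pd i) i, Finset.sum_neg_distrib, neg_neg]
        rw [integral_finsetSum _ fun i _ => hint i]
    _ = 0 := by simp only [fun x => sum_pd_pd_mul_sub_eq_zero hφ2 (u x) x, integral_zero]

theorem eq_zero_of_forall_isTest_integral_eq_zero (hΩ : IsOpen Ω) {s : L2S Ω}
    (hs : ∀ φ : E3 → ℝ, IsTest Ω φ → ∫ x in Ω, (φ x : ℂ) * s x = 0) : s = 0 := by
  have hloc : LocallyIntegrableOn (s : E3 → ℂ) Ω volume :=
    locallyIntegrableOn_of_locallyIntegrable_restrict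
      ((Lp.memLp s).locallyIntegrable one_le_two)
  refine Lp.eq_zero_iff_ae_eq_zero.2 ((ae_restrict_iff' hΩ.measurableSet).2
    (hΩ.ae_eq_zero_of_integral_contDiff_smul_eq_zero hloc fun φ h1 h2 h3 => ?_))
  have hcompl (x : E3) (hx : x ∉ Ω) : φ x • s x = 0 := by
    rw [image_eq_zero_of_notMem_tsupport fun hx' => hx (h3 hx'), zero_smul]
  rw [← setIntegral_eq_integral_of_forall_compl_eq_zero hcompl]
  simpa only [Complex.real_smul] using hs φ ⟨h1, h2, h3⟩

end WeakDerivatives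

namespace DeRham

variable {Ω : Set E3} (C : DeRham Ω)

theorem d1_mem_kernel (hΩ : IsOpen Ω) (x : C.d1.domain) : C.d1 x ∈ kernel C.d2 := by
  have hzero : C.d2 ⟨C.d1 x, C.d1_mem x⟩ = 0 :=
    eq_zero_of_forall_isTest_integral_eq_zero hΩ fun _ hφ =>
      (C.d1_curl x).integral_mul_eq_zero (C.d2_div ⟨C.d1 x, C.d1_mem x⟩) hφ
  exact mem_kernel.2 ((LinearPMap.mem_graph_iff _).2 ⟨⟨C.d1 x, C.d1_mem x⟩, rfl, hzero⟩)

end DeRham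

end FluidComplex

open FluidComplex in
theorem mainTheorem4_general {E F G : Type*} [NormedAddCommGroup E] [InnerProductSpace ℂ E]
    [CompleteSpace E] [NormedAddCommGroup F] [InnerProductSpace ℂ F] [CompleteSpace F]
    [NormedAddCommGroup G] [InnerProductSpace ℂ G] [CompleteSpace G]
    {S : F →ₗ.[ℂ] G} {R : F →ₗ.[ℂ] E} (hS_dense : Dense (S.domain : Set F)) (hS : S.IsClosed)
    (hR : R.IsClosed) (hSR : (kernel S)ᗮ ≤ kernel R)
    (hu : IsCompactOperator (DomInter.incl S R))
    (hp : IsCompactOperator (DomInter.incl (DeRham.zeroOp G) S.adjoint)) {ν : ℝ} (hν : 0 < ν)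
    {lam : ℝ} (hlam : lam ≠ 0) (l3 : E →L[ℂ] F) (l5 : F →L[ℂ] F) :
    {γ : ℂ | ¬(saddleOperator S R ν lam l3 l5 + γ • saddlePairing S R).IsInvertible}.Countable := by
  have hK := isCompactOperator_saddlePairing hu hp
  have := completeSpace_saddleTrial hS_dense hS hR
  have hinv := isInvertible_saddleOperator_add_smul hS_dense hS hR hSR hν hlam
    (lt_add_one (‖l5‖ + ‖l3‖ ^ 2 / (2 * ν)))
  -- Generalizing keeps unification from unfolding the two operators.
  generalize saddleOperator S R ν lam l3 l5 = A at hinv ⊢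
  generalize saddlePairing S R = K at hinv hK ⊢
  exact countable_setOf_not_isInvertible_add_smul (𝕜 := ℂ) (X := SaddleTrial S R)
    (Y := SaddleTest S R →L⋆[ℂ] ℂ) (A := A) (K := K) hK hinv

theorem mainTheorem4 (Ω : Set FluidComplex.E3) (hΩ_open : IsOpen Ω) (hΩ_conn : IsConnected Ω)
    (hΩ_bdd : Bornology.IsBounded Ω)
    (C : FluidComplex.DeRham Ω) (hC : C.CompactnessProperty)
    (ν : ℝ) (hν : 0 < ν) (lam : ℝ) (hlam : 0 < lam)
    (l3 l5 : FluidComplex.L2V Ω →L[ℂ] FluidComplex.L2V Ω) :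
    {γ : ℂ | ¬ (C.Lbar ν lam l3 l5 + γ • C.innerOp).IsInvertible}.Countable :=
  -- By definition, `L̄_lam` is `saddleOperator` and `⟨·, ·⟩` is `saddlePairing` for `d` and `d*`.
  mainTheorem4_general C.d2_dense C.d2_closed (LinearPMap.adjoint_isClosed C.d1_dense)
    (FluidComplex.orthogonal_kernel_le_kernel_adjoint C.d1_dense (C.d1_mem_kernel hΩ_open))
    hC.deg2 hC.deg3 hν hlam.ne' l3 l5
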